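/- Shuffle a deck of $n\ge 0$ cards labelled $1,\dots,n$ once by a riffle shuffle: cut off the first $t$ cards ($0\le t\le n$) as the first pile $A=[1,\dots,t]$, let $B=[t+1,\dots,n]$ be the second pile, and interleave the two piles, keeping the cards of each pile in increasing order. Outcomes with different cuts $t$ are counted as different, so there are $2^n$ outcomes. Let $h=\lceil n/2\rceil$, and call the positions $1,\dots,h$ the top half of the shuffled deck. At position $p$ of the top half the player guesses the card $\lfloor p/2\rfloor+1$ (that is, the guesses are $1,2,2,3,3,4,4,\dots$). Let $Y_A$ be the number of positions in the top half at which the guess is correct and the card comes from the first pile $A$, and let $C[Y_A^r]$ denote the sum of $Y_A^r$ over all $2^n$ outcomes. Then, for every integer $r\ge 0$ and each parity class $e\in\{0,1\}$, there are polynomials $P$ and $Q$ with rational coefficients, depending only on $r$ and $e$, of degrees at most $\lceil r/2\rceil$ and $\lfloor r/2\rfloor$ respectively, such that for every $n\ge 0$ for which $h=\lceil n/2\rceil\equiv e\pmod 2$, with $L=\lceil h/2\rceil$, $$C[Y_A^r]=2^n\left[P(L)\binom{2L}{L}\frac{1}{4^L}+Q(L)\right].$$ -/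

import Mathlib

/-- The outcomes of one riffle shuffle of a deck of `n` cards labelled `1, …, n`.

An outcome is a pair `(t, π)`: `t` is the number of cards cut off into the first pile, and `π` sends
each position of the shuffled deck to the card found there. Positions and cards are indexed from `0`,
so that position `i` and card `c` of `Fin n` are the paper-and-pencil position `i + 1` and the card
labelled `c + 1`. The first pile consists of the cards `c < t`, the second one of the cards `t ≤ c`,
and interleaving keeps the cards of each pile in increasing order. The identity arrangement occurs
once for every cut, so it is counted `n + 1` times. -/
def riffleOutcomes (n : ℕ) : Finset (Fin (n + 1) × Equiv.Perm (Fin n)) :=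
  Finset.univ.filter fun ω =>
    (∀ i j : Fin n, i < j → (ω.2 i : ℕ) < ω.1 → (ω.2 j : ℕ) < ω.1 → ω.2 i < ω.2 j) ∧
    (∀ i j : Fin n, i < j → (ω.1 : ℕ) ≤ ω.2 i → (ω.1 : ℕ) ≤ ω.2 j → ω.2 i < ω.2 j)

/-- The sum `C[f]` of a statistic `f` over all outcomes of one riffle shuffle of `n` cards. -/
def outcomeSum (n : ℕ) (f : Fin (n + 1) × Equiv.Perm (Fin n) → ℕ) : ℕ :=
  ∑ ω ∈ riffleOutcomes n, f ω

/-- The length `h = ⌈n / 2⌉` of the top half of the deck. -/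
def topHalf (n : ℕ) : ℕ := ⌈(n : ℚ) / 2⌉₊

/-- The label guessed at position `p` (`1 ≤ p ≤ n`): the guesses are `1, 2, 2, 3, 3, 4, 4, …` in
the top half, and the mirror image `…, n-2, n-2, n-1, n-1, n` in the bottom half. -/
def guess (n p : ℕ) : ℕ :=
  if p ≤ topHalf n then p / 2 + 1 else n + 1 - ((n + 1 - p) / 2 + 1)

/-- `Y_A`: the number of positions in the top half where the guess is correct and the card comes
from the first pile. -/
def correctTopFirst (n : ℕ) (ω : Fin (n + 1) × Equiv.Perm (Fin n)) : ℕ :=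
  (Finset.univ.filter fun i : Fin n =>
    (i : ℕ) + 1 ≤ topHalf n ∧ (ω.2 i : ℕ) + 1 = guess n ((i : ℕ) + 1) ∧
      (ω.2 i : ℕ) < ω.1).card

/-!
An outcome of the shuffle is determined by the word recording which positions hold cards of the
first pile `A` (`pileWord`), and every word occurs. Read the word as a `±1` walk started at `0`,
stepping up at the cards of `A`. A card of `A` at position `p` carries the label equal to the number
of cards of `A` up to `p`, so the guess `⌊p/2⌋ + 1` is right there exactly when the walk steps up
from level `0` or `1`. Hence `Y_A` is the number of up-steps from these two levels among the first
`h` steps (`correctTopFirst_eq_upSteps`).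

For a walk started at level `x`, let `F_k(x) = ∑ₕ E[binom (Y, k)] Xʰ`. Conditioning on the first
step gives `2 F_k(x) = X (F_k(x+1) + F_k(x-1) + [x ∈ {0, 1}] F_{k-1}(x+1))` for `k ≥ 1`, and this
determines `F_k` from `F_0 = 1 / (1 - X)`. The solution is explicit: with `R = 1 / √(1 - X²)` and
`λ = (1 - √(1 - X²)) / X`, it decays by a factor `λ` per level away from `{0, 1}`, and for `k ≥ 2`
one has `F_k(0) = (R - 1)^(k-1) H` and `F_k(1) = X F_k(0)` with `H = R (1 + λ) / (2 (1 - X))`, while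
`F_1(0) = F_1(1) = X H` (`binomMomentSeries_succ`, `sum_choose_upSteps`).

Splitting `X F_k(0)` into its parts of even and of odd degree turns both into polynomials in `R` of
degree at most `k + 2` (`X_mul_binomMomentSeries_succ_eq`). From `X R' = R³ - R`, the coefficient of
`Xⁿ` in `R^(m+2)` is `1 + n/m` times that in `R^m`. So at `n = 2L` an odd power `R^(2j+1)`
contributes a polynomial of degree `j` in `L` times `binom (2L, L) / 4^L`, and an even power
`R^(2j+2)` a polynomial of degree `j` (`isCentralBinomForm_returnSeries_pow`). Writing `y^r` as a
combination of the `binom (y, k)` with `k ≤ r` finishes the proof.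
-/

/-! ### Powers of the return series -/

open PowerSeries in
/-- The return series `R = 1 / √(1 - X²)` of the simple random walk on `ℤ`: its coefficient at `n`
is the probability that the walk is back at its start after `n` steps. That it is the inverse square
root is `one_sub_sq_mul_returnSeries_sq`. -/
noncomputable def returnSeries : ℚ⟦X⟧ :=
  mk fun n => if Even n then (Nat.centralBinom (n / 2) : ℚ) / 4 ^ (n / 2) else 0

section ReturnSeries
open PowerSeries

lemma coeff_returnSeries_two_mul (m : ℕ) :
    coeff (2 * m) returnSeries = (Nat.choose (2 * m) m : ℚ) / 4 ^ m := by
  simp [returnSeries, Nat.centralBinom]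

lemma coeff_returnSeries_of_odd {n : ℕ} (h : ¬ Even n) : coeff n returnSeries = 0 := by
  simp [returnSeries, h]

lemma coeff_returnSeries_add_two (n : ℕ) :
    ((n : ℚ) + 2) * coeff (n + 2) returnSeries = (n + 1) * coeff n returnSeries := by
  rcases Nat.even_or_odd n with h | h
  · obtain ⟨m, rfl⟩ := h.two_dvd
    have e : 2 * m + 2 = 2 * (m + 1) := by ring
    have hc : ((m : ℚ) + 1) * Nat.centralBinom (m + 1) = 2 * (2 * m + 1) * Nat.centralBinom m := by
      exact_mod_cast Nat.succ_mul_centralBinom_succ m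
    rw [Nat.centralBinom, Nat.centralBinom] at hc
    rw [e, coeff_returnSeries_two_mul, coeff_returnSeries_two_mul]
    rw [pow_succ]
    push_cast
    field_simp
    linear_combination 2 * hc
  · rw [coeff_returnSeries_of_odd (by simpa [Nat.even_add] using h),
      coeff_returnSeries_of_odd (by simpa using h)]
    simp

lemma coeff_X_mul_derivative (f : ℚ⟦X⟧) (n : ℕ) :
    coeff n (X * derivative ℚ f) = n * coeff n f := by
  cases n with
  | zero => simp
  | succ n => rw [coeff_succ_X_mul, coeff_derivative]; push_cast; ring

lemma one_sub_sq_mul_derivative_returnSeries :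
    (1 - X ^ 2) * derivative ℚ returnSeries = X * returnSeries := by
  apply mul_left_cancel₀ (X_ne_zero : (X : ℚ⟦X⟧) ≠ 0)
  have key : X * derivative ℚ returnSeries
      = X * (X * (X * derivative ℚ returnSeries)) + X * (X * returnSeries) := by
    ext n
    rcases n with _ | _ | n
    · simp
    · rw [map_add, coeff_X_mul_derivative, coeff_succ_X_mul, coeff_succ_X_mul,
        coeff_returnSeries_of_odd (by decide)]
      simp
    · rw [map_add, coeff_X_mul_derivative]
      simp only [coeff_succ_X_mul, coeff_X_mul_derivative]
      have := coeff_returnSeries_add_two n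
      push_cast
      linear_combination this
  linear_combination key

lemma constantCoeff_returnSeries : constantCoeff returnSeries = 1 := by
  simp [← coeff_zero_eq_constantCoeff_apply, returnSeries]

/-- The derivative of the left side vanishes. -/
lemma one_sub_sq_mul_returnSeries_sq : (1 - X ^ 2) * returnSeries ^ 2 = 1 := by
  apply derivative.ext
  · simp only [Derivation.leibniz, Derivation.leibniz_pow, map_sub, derivative_X, derivative_one,
      smul_eq_mul, nsmul_eq_mul]
    push_cast
    linear_combination 2 * returnSeries * one_sub_sq_mul_derivative_returnSeries
  · simp [constantCoeff_returnSeries]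

/-- The differential equation `X R' = R³ - R`, in the form it takes for the powers of `R`. -/
lemma X_mul_derivative_returnSeries_pow (m : ℕ) :
    X * derivative ℚ (returnSeries ^ m)
      = (m : ℚ⟦X⟧) * (returnSeries ^ (m + 2) - returnSeries ^ m) := by
  have h1 := one_sub_sq_mul_derivative_returnSeries
  have h2 := one_sub_sq_mul_returnSeries_sq
  have h3 : X * derivative ℚ returnSeries = returnSeries ^ 3 - returnSeries := by
    linear_combination returnSeries ^ 2 * X * h1
      + (-X * derivative ℚ returnSeries - returnSeries) * h2
  cases m with
  | zero => simp
  | succ m =>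
    rw [derivative_pow]
    simp only [Nat.add_sub_cancel]
    linear_combination ((m + 1 : ℕ) : ℚ⟦X⟧) * returnSeries ^ m * h3

lemma coeff_returnSeries_pow_add_two (m n : ℕ) :
    ((m : ℚ) + 1) * coeff n (returnSeries ^ (m + 3))
      = (m + 1 + n) * coeff n (returnSeries ^ (m + 1)) := by
  have h := congrArg (coeff n) (X_mul_derivative_returnSeries_pow (m + 1))
  rw [coeff_X_mul_derivative, ← nsmul_eq_mul (m + 1), map_nsmul, map_sub, nsmul_eq_mul] at h
  push_cast at h
  linear_combination -h

lemma coeff_returnSeries_sq (n : ℕ) :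
    coeff n (returnSeries ^ 2) = if Even n then 1 else 0 := by
  have h : returnSeries ^ 2 = 1 + X * (X * returnSeries ^ 2) := by
    linear_combination one_sub_sq_mul_returnSeries_sq
  induction n using Nat.twoStepInduction with
  | zero => simp [constantCoeff_returnSeries]
  | one => rw [h]; simp [coeff_succ_X_mul, coeff_one]
  | more n ih _ =>
    rw [h, map_add, coeff_succ_X_mul, coeff_succ_X_mul, ih]
    simp [coeff_one, Nat.even_add]

lemma coeff_returnSeries_pow_of_odd (m : ℕ) {n : ℕ} (hn : ¬ Even n) :
    coeff n (returnSeries ^ (m + 1)) = 0 := by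
  induction m using Nat.twoStepInduction with
  | zero => simpa using coeff_returnSeries_of_odd hn
  | one => simp [coeff_returnSeries_sq, hn]
  | more m ih _ =>
    have h := coeff_returnSeries_pow_add_two m n
    rw [ih, mul_zero] at h
    exact (mul_eq_zero.mp h).resolve_left (by positivity)

open Polynomial in
/-- `a L = P L * binom (2L, L) / 4^L + Q L` for all `L`, with polynomials `P` of degree at most
`⌊m/2⌋` and `Q` of degree at most `⌊(m - 1)/2⌋`; for `m = 0` this means `Q = 0`. -/
def IsCentralBinomForm (m : ℕ) (a : ℕ → ℚ) : Prop :=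
  ∃ P ∈ degreeLT ℚ (m / 2 + 1), ∃ Q ∈ degreeLT ℚ ((m + 1) / 2),
    ∀ L : ℕ, a L = P.eval (L : ℚ) * ((Nat.choose (2 * L) L : ℚ) / 4 ^ L) + Q.eval (L : ℚ)

lemma IsCentralBinomForm.mono {k l : ℕ} (hkl : k ≤ l) {a : ℕ → ℚ} (h : IsCentralBinomForm k a) :
    IsCentralBinomForm l a := by
  obtain ⟨P, hP, Q, hQ, h⟩ := h
  exact ⟨P, Polynomial.degreeLT_mono (by omega) hP, Q, Polynomial.degreeLT_mono (by omega) hQ, h⟩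

lemma IsCentralBinomForm.add {k : ℕ} {a b : ℕ → ℚ} (ha : IsCentralBinomForm k a)
    (hb : IsCentralBinomForm k b) : IsCentralBinomForm k (fun L => a L + b L) := by
  obtain ⟨P, hP, Q, hQ, h⟩ := ha
  obtain ⟨P', hP', Q', hQ', h'⟩ := hb
  refine ⟨P + P', add_mem hP hP', Q + Q', add_mem hQ hQ', fun L => ?_⟩
  simp only [h, h', Polynomial.eval_add]
  ring

lemma IsCentralBinomForm.const_mul {k : ℕ} {a : ℕ → ℚ} (c : ℚ) (ha : IsCentralBinomForm k a) :
    IsCentralBinomForm k (fun L => c * a L) := by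
  obtain ⟨P, hP, Q, hQ, h⟩ := ha
  refine ⟨c • P, Submodule.smul_mem _ c hP, c • Q, Submodule.smul_mem _ c hQ, fun L => ?_⟩
  simp only [h, Polynomial.eval_smul, smul_eq_mul]
  ring

lemma isCentralBinomForm_zero (k : ℕ) : IsCentralBinomForm k (fun _ => 0) :=
  ⟨0, zero_mem _, 0, zero_mem _, by simp⟩

lemma IsCentralBinomForm.sum {ι : Type*} {k : ℕ} {s : Finset ι} {a : ι → ℕ → ℚ}
    (h : ∀ i ∈ s, IsCentralBinomForm k (a i)) :
    IsCentralBinomForm k (fun L => ∑ i ∈ s, a i L) := by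
  have := Finset.sum_induction a (IsCentralBinomForm k) (fun _ _ => .add)
    (isCentralBinomForm_zero k) h
  convert this using 1
  ext L
  simp

lemma isCentralBinomForm_one : IsCentralBinomForm 1 (fun _ => 1) :=
  ⟨0, zero_mem _, 1, by simp [Polynomial.mem_degreeLT], by simp⟩

lemma linear_mul_mem_degreeLT (a b : ℚ) {n : ℕ} {P : Polynomial ℚ}
    (hP : P ∈ Polynomial.degreeLT ℚ n) :
    (.C a * .X + .C b) * P ∈ Polynomial.degreeLT ℚ (n + 1) := by
  by_cases h0 : P = 0
  · simp [h0]
  rw [Polynomial.mem_degreeLT, ← Polynomial.natDegree_lt_iff_degree_lt h0] at hP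
  rw [Polynomial.mem_degreeLT]
  refine Polynomial.degree_le_natDegree.trans_lt ?_
  have h1 := Polynomial.natDegree_mul_le (p := .C a * .X + .C b) (q := P)
  have h2 := Polynomial.natDegree_linear_le (a := a) (b := b)
  exact_mod_cast (by omega)

/-- The powers of `R` are reached in steps of two: multiplication by `R²` multiplies the
coefficients by a linear polynomial. The odd powers carry the central binomial coefficient, the
even powers do not. -/
lemma isCentralBinomForm_returnSeries_pow (m : ℕ) :
    IsCentralBinomForm m (fun L => coeff (2 * L) (returnSeries ^ (m + 1))) := by
  induction m using Nat.twoStepInduction with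
  | zero =>
    exact ⟨1, by simp [Polynomial.mem_degreeLT], 0, zero_mem _, by
      simp [coeff_returnSeries_two_mul]⟩
  | one =>
    exact ⟨0, zero_mem _, 1, by simp [Polynomial.mem_degreeLT], by
      simp [coeff_returnSeries_sq]⟩
  | more m ih _ =>
    obtain ⟨P, hP, Q, hQ, h⟩ := ih
    refine ⟨_, Polynomial.degreeLT_mono (by omega) (linear_mul_mem_degreeLT (2 / (m + 1)) 1 hP),
      _, Polynomial.degreeLT_mono (by omega) (linear_mul_mem_degreeLT (2 / (m + 1)) 1 hQ),
      fun L => ?_⟩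
    have h1 := coeff_returnSeries_pow_add_two m (2 * L)
    have h2 : coeff (2 * L) (returnSeries ^ (m + 3))
        = (2 / (m + 1) * L + 1) * coeff (2 * L) (returnSeries ^ (m + 1)) := by
      have : (m : ℚ) + 1 ≠ 0 := by positivity
      field_simp
      push_cast at h1
      linear_combination h1
    have h3 := h L
    simp only at h3
    simp only [h2, h3, Polynomial.eval_mul, Polynomial.eval_add, Polynomial.eval_C,
      Polynomial.eval_X]
    ring

lemma isCentralBinomForm_returnSeries_mul_aeval {m : ℕ} {p : Polynomial ℚ} (hp : p.natDegree ≤ m) :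
    IsCentralBinomForm m (fun L => coeff (2 * L) (returnSeries * p.aeval returnSeries)) := by
  have : (fun L => coeff (2 * L) (returnSeries * p.aeval returnSeries)) = fun L =>
      ∑ i ∈ Finset.range (m + 1), p.coeff i * coeff (2 * L) (returnSeries ^ (i + 1)) := by
    ext L
    rw [Polynomial.aeval_eq_sum_range' (n := m + 1) (by omega), Finset.mul_sum, map_sum]
    refine Finset.sum_congr rfl fun i _ => ?_
    rw [mul_smul_comm, map_smul, smul_eq_mul, pow_succ']
  rw [this]
  exact .sum fun i hi => .const_mul _ <|
    (isCentralBinomForm_returnSeries_pow i).mono (by simpa [Nat.lt_succ_iff] using hi)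

lemma coeff_returnSeries_mul_aeval_of_odd (p : Polynomial ℚ) {n : ℕ} (hn : ¬ Even n) :
    coeff n (returnSeries * p.aeval returnSeries) = 0 := by
  rw [Polynomial.aeval_eq_sum_range, Finset.mul_sum, map_sum]
  refine Finset.sum_eq_zero fun i _ => ?_
  rw [mul_smul_comm, map_smul, ← pow_succ', coeff_returnSeries_pow_of_odd i hn, smul_zero]

end ReturnSeries

/-! ### Generating functions of the binomial moments -/

open PowerSeries in
/-- The first-passage series `λ = (1 - √(1 - X²)) / X` of the simple random walk: its coefficient at
`n` is the probability that the walk first reaches a given neighbouring level at time `n`. Here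
`√(1 - X²)` is written as `(1 - X²) R`. -/
noncomputable def passageSeries : ℚ⟦X⟧ :=
  mk fun n => coeff (n + 1) (1 - (1 - X ^ 2) * returnSeries)

section WalkSeries
open PowerSeries

lemma X_mul_passageSeries : X * passageSeries = 1 - (1 - X ^ 2) * returnSeries := by
  ext n
  cases n with
  | zero => simp [constantCoeff_returnSeries]
  | succ n => rw [coeff_succ_X_mul, passageSeries, coeff_mk]

lemma passageSeries_mul : passageSeries * (1 + (1 - X ^ 2) * returnSeries) = X := by
  apply mul_left_cancel₀ (X_ne_zero : (X : ℚ⟦X⟧) ≠ 0)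
  linear_combination (1 + (1 - X ^ 2) * returnSeries) * X_mul_passageSeries
    - (1 - X ^ 2) * one_sub_sq_mul_returnSeries_sq

lemma X_mul_passageSeries_sq : X * (1 + passageSeries ^ 2) = 2 * passageSeries := by
  linear_combination passageSeries * X_mul_passageSeries - passageSeries_mul

/-- The function of the starting level `x` that is `a` at `x = 0`, `b` at `x = 1`, and decays by a
factor `λ` with each further step away from `{0, 1}`. -/
noncomputable def levelSeries (a b : ℚ⟦X⟧) (x : ℤ) : ℚ⟦X⟧ :=
  if x ≤ 0 then passageSeries ^ x.natAbs * a else passageSeries ^ (x - 1).natAbs * b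

lemma levelSeries_zero (a b : ℚ⟦X⟧) : levelSeries a b 0 = a := by simp [levelSeries]

lemma levelSeries_one (a b : ℚ⟦X⟧) : levelSeries a b 1 = b := by simp [levelSeries]

lemma levelSeries_two (a b : ℚ⟦X⟧) : levelSeries a b 2 = passageSeries * b := by
  simp [levelSeries]

lemma levelSeries_neg_one (a b : ℚ⟦X⟧) : levelSeries a b (-1) = passageSeries * a := by
  simp [levelSeries]

/-- Away from `{0, 1}` no step is counted, and the first-step equation is homogeneous. -/
lemma levelSeries_harmonic (a b : ℚ⟦X⟧) {x : ℤ} (h0 : x ≠ 0) (h1 : x ≠ 1) :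
    2 * levelSeries a b x = X * (levelSeries a b (x + 1) + levelSeries a b (x - 1)) := by
  rcases lt_or_gt_of_ne h0 with hx | hx
  · obtain ⟨j, rfl⟩ : ∃ j : ℕ, x = -(j + 1 : ℤ) := ⟨(-x - 1).toNat, by omega⟩
    have e0 : (-(j + 1 : ℤ)).natAbs = j + 1 := by omega
    have e1 : (-(j + 1 : ℤ) + 1).natAbs = j := by omega
    have e2 : (-(j + 1 : ℤ) - 1).natAbs = j + 2 := by omega
    rw [levelSeries, levelSeries, levelSeries, if_pos (by omega), if_pos (by omega),
      if_pos (by omega), e0, e1, e2]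
    linear_combination -passageSeries ^ j * a * X_mul_passageSeries_sq
  · obtain ⟨j, rfl⟩ : ∃ j : ℕ, x = (j + 2 : ℤ) := ⟨(x - 2).toNat, by omega⟩
    have e0 : ((j + 2 : ℤ) - 1).natAbs = j + 1 := by omega
    have e1 : ((j + 2 : ℤ) + 1 - 1).natAbs = j + 2 := by omega
    have e2 : ((j + 2 : ℤ) - 1 - 1).natAbs = j := by omega
    rw [levelSeries, levelSeries, levelSeries, if_neg (by omega), if_neg (by omega),
      if_neg (by omega), e0, e1, e2]
    linear_combination -passageSeries ^ j * b * X_mul_passageSeries_sq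

/-- The series `1 / (1 - X)`. -/
noncomputable def geomSeries : ℚ⟦X⟧ := mk fun _ => 1

lemma geomSeries_eq_one_add : geomSeries = 1 + X * geomSeries := by
  ext n
  cases n with
  | zero => simp [geomSeries]
  | succ n => rw [map_add, coeff_succ_X_mul]; simp [geomSeries, coeff_one]

lemma geomSeries_eq : geomSeries = (1 + X) * returnSeries ^ 2 := by
  linear_combination (1 + X) * returnSeries ^ 2 * geomSeries_eq_one_add
    - geomSeries * one_sub_sq_mul_returnSeries_sq

lemma two_mul_C_half : (2 : ℚ⟦X⟧) * C (1 / 2) = 1 := by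
  rw [← map_ofNat (C : ℚ →+* ℚ⟦X⟧) 2, ← map_mul]
  norm_num

/-- The common factor `H = R (1 + λ) / (2 (1 - X))` of all binomial moment series. -/
noncomputable def momentFactor : ℚ⟦X⟧ :=
  C (1 / 2) * (returnSeries * (1 + passageSeries) * geomSeries)

lemma two_mul_momentFactor :
    2 * momentFactor = returnSeries * (1 + passageSeries) * geomSeries := by
  rw [momentFactor, ← mul_assoc, two_mul_C_half, one_mul]

lemma two_mul_X_mul_momentFactor :
    2 * (X * momentFactor) = returnSeries * (returnSeries - 1) * (2 * returnSeries + 1)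
      + X * (returnSeries ^ 2 * (2 * returnSeries - 1)) := by
  have h1 := two_mul_momentFactor
  rw [geomSeries_eq] at h1
  have h2 := one_sub_sq_mul_returnSeries_sq
  linear_combination X * h1 + returnSeries ^ 3 * (1 + X) * X_mul_passageSeries
    - (returnSeries ^ 2 * (1 + X) + returnSeries) * h2

/-- The first-step equation at the levels `0` and `1` for `k = 1`, divided by `X`. -/
lemma momentFactor_eq : 2 * momentFactor
    = X * momentFactor + X * passageSeries * momentFactor + geomSeries := by
  have h : 2 * (2 * momentFactor)
      = 2 * (X * momentFactor + X * passageSeries * momentFactor + geomSeries) := by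
    linear_combination (2 - X - X * passageSeries) * two_mul_momentFactor
      - returnSeries * (2 + passageSeries) * geomSeries * X_mul_passageSeries
      + returnSeries * geomSeries * passageSeries_mul
      + 2 * geomSeries * one_sub_sq_mul_returnSeries_sq
  linear_combination C (1 / 2) * h + (X * momentFactor + X * passageSeries * momentFactor
    + geomSeries - 2 * momentFactor) * two_mul_C_half

/-- The series `∑ₕ E[binom (Y, k)] Xʰ`, where `Y` is the number of up-steps from the levels `0` and
`1` among the first `h` steps of a simple random walk started at `x`. It is defined by its closed
form; the probabilistic meaning is `sum_choose_upSteps`. -/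
noncomputable def binomMomentSeries : ℕ → ℤ → ℚ⟦X⟧
  | 0, _ => geomSeries
  | 1, x => levelSeries (X * momentFactor) (X * momentFactor) x
  | k + 2, x => levelSeries ((returnSeries - 1) ^ (k + 1) * momentFactor)
      (X * ((returnSeries - 1) ^ (k + 1) * momentFactor)) x

lemma binomMomentSeries_succ_at_one (k : ℕ) :
    binomMomentSeries (k + 1) 1 = X * ((returnSeries - 1) ^ k * momentFactor) := by
  cases k <;> simp [binomMomentSeries, levelSeries_one]

lemma binomMomentSeries_succ_at_two (k : ℕ) : binomMomentSeries (k + 1) 2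
    = passageSeries * (X * ((returnSeries - 1) ^ k * momentFactor)) := by
  cases k <;> simp [binomMomentSeries, levelSeries_two]

lemma binomMomentSeries_succ (k : ℕ) (x : ℤ) :
    2 * binomMomentSeries (k + 1) x
      = X * (binomMomentSeries (k + 1) (x + 1) + binomMomentSeries (k + 1) (x - 1)
        + if x = 0 ∨ x = 1 then binomMomentSeries k (x + 1) else 0) := by
  by_cases h0 : x = 0
  · subst h0
    cases k with
    | zero =>
      simp only [binomMomentSeries, zero_add, zero_sub, levelSeries_zero, levelSeries_one,
        levelSeries_neg_one, true_or, if_true]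
      linear_combination X * momentFactor_eq
    | succ k =>
      simp only [zero_add, zero_sub, true_or, if_true, binomMomentSeries_succ_at_one]
      simp only [binomMomentSeries, levelSeries_zero, levelSeries_neg_one]
      linear_combination (returnSeries - 1) ^ k * momentFactor *
        (one_sub_sq_mul_returnSeries_sq - (returnSeries - 1) * X_mul_passageSeries)
  by_cases h1 : x = 1
  · subst h1
    cases k with
    | zero =>
      simp only [binomMomentSeries, one_add_one_eq_two, sub_self, levelSeries_zero,
        levelSeries_one, levelSeries_two, or_true, if_true]
      linear_combination X * momentFactor_eq
    | succ k =>
      simp only [one_add_one_eq_two, sub_self, or_true, if_true, binomMomentSeries_succ_at_one,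
        binomMomentSeries_succ_at_two]
      simp only [binomMomentSeries, levelSeries_zero]
      linear_combination X * (returnSeries - 1) ^ k * momentFactor *
        (one_sub_sq_mul_returnSeries_sq - returnSeries * X_mul_passageSeries)
  · rw [if_neg (by tauto), add_zero]
    cases k <;> exact levelSeries_harmonic _ _ h0 h1

/-- As `R` is even, the summands on the right are separated by the parity of the exponent. -/
lemma coeff_even_odd_of_X_mul_eq {f : ℚ⟦X⟧} {p q : Polynomial ℚ} {c : ℚ}
    (h : X * f = returnSeries * p.aeval returnSeries
      + X * (returnSeries * q.aeval returnSeries) + C c) (L : ℕ) :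
    coeff (2 * L) f = coeff (2 * L) (returnSeries * q.aeval returnSeries) ∧
      coeff (2 * L + 1) f = coeff (2 * (L + 1)) (returnSeries * p.aeval returnSeries) := by
  constructor
  · rw [← coeff_succ_X_mul, h, map_add, map_add, coeff_succ_X_mul, coeff_C, if_neg (by omega),
      coeff_returnSeries_mul_aeval_of_odd p (by simp)]
    ring
  · rw [← coeff_succ_X_mul, h, map_add, map_add, coeff_succ_X_mul, coeff_C, if_neg (by omega),
      coeff_returnSeries_mul_aeval_of_odd q (by simp)]
    ring_nf

/-- The part of odd degree and the part of even degree of the moment series are polynomials in `R`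
of controlled degree. The constant `c` is harmless, as it only enters the vanishing coefficient of
`X⁰` on the left. -/
lemma X_mul_binomMomentSeries_succ_eq (k : ℕ) : ∃ p q : Polynomial ℚ, ∃ c : ℚ,
    p.natDegree ≤ k + 2 ∧ q.natDegree ≤ k + 2 ∧ X * binomMomentSeries (k + 1) 0
      = returnSeries * p.aeval returnSeries + X * (returnSeries * q.aeval returnSeries) + C c := by
  cases k with
  | zero =>
    -- For `k = 1` the second factor `X` brings in `X² R² (2 R - 1)`, which is the polynomial
    -- `(R² - 1) (2 R - 1)` in `R`, with constant term `1`.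
    refine ⟨.C (1 / 2) * (2 * .X ^ 2 - .X - 2), .C (1 / 2) * ((.X - 1) * (2 * .X + 1)), 1 / 2,
      ?_, ?_, ?_⟩
    · compute_degree
    · compute_degree
    · simp only [map_mul, map_sub, map_add, map_pow, map_ofNat, map_one, Polynomial.aeval_C,
        Polynomial.aeval_X, binomMomentSeries, levelSeries_zero, algebraMap_eq]
      linear_combination C (1 / 2) * X * two_mul_X_mul_momentFactor
        - X * X * momentFactor * two_mul_C_half
        - C (1 / 2) * (2 * returnSeries - 1) * one_sub_sq_mul_returnSeries_sq
  | succ k =>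
    refine ⟨.C (1 / 2) * ((.X - 1) ^ (k + 2) * (2 * .X + 1)),
      .C (1 / 2) * (.X * (.X - 1) ^ (k + 1) * (2 * .X - 1)), 0, ?_, ?_, ?_⟩
    · compute_degree
    · compute_degree
      omega
    · simp only [map_mul, map_sub, map_add, map_pow, map_ofNat, map_one, map_zero,
        Polynomial.aeval_C, Polynomial.aeval_X, binomMomentSeries, levelSeries_zero, algebraMap_eq]
      linear_combination (returnSeries - 1) ^ (k + 1) *
        (C (1 / 2) * two_mul_X_mul_momentFactor - X * momentFactor * two_mul_C_half)

lemma isCentralBinomForm_binomMomentSeries_even (k : ℕ) :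
    IsCentralBinomForm (k + 1) (fun L => coeff (2 * L) (binomMomentSeries k 0)) := by
  cases k with
  | zero => simpa [binomMomentSeries, geomSeries] using isCentralBinomForm_one
  | succ k =>
    obtain ⟨p, q, c, -, hq, h⟩ := X_mul_binomMomentSeries_succ_eq k
    simp only [(coeff_even_odd_of_X_mul_eq h _).1]
    exact isCentralBinomForm_returnSeries_mul_aeval hq

/-- The shift from `L` to `L + 1` is that from `⌊h/2⌋` to `⌈h/2⌉` for `h = 2L + 1`. -/
lemma exists_isCentralBinomForm_binomMomentSeries_odd (k : ℕ) :
    ∃ a, IsCentralBinomForm (k + 1) a ∧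
      ∀ L, coeff (2 * L + 1) (binomMomentSeries k 0) = a (L + 1) := by
  cases k with
  | zero => exact ⟨_, isCentralBinomForm_one, by simp [binomMomentSeries, geomSeries]⟩
  | succ k =>
    obtain ⟨p, q, c, hp, -, h⟩ := X_mul_binomMomentSeries_succ_eq k
    exact ⟨_, isCentralBinomForm_returnSeries_mul_aeval hp,
      fun L => (coeff_even_odd_of_X_mul_eq h L).2⟩

end WalkSeries

/-! ### Words as walks -/

/-- A word `w` is read as a `±1` walk started at `x`, with an up-step for `true` and a down-step for
`false`: this is its level before step `i`. -/
def walkLevel {n : ℕ} (x : ℤ) (w : Fin n → Bool) (i : Fin n) : ℤ :=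
  x + 2 * (∑ j, if j < i ∧ w j then 1 else 0) - i

/-- The number of up-steps from the levels `0` and `1` among the first `h` steps of the walk `w`
started at `x`. -/
def upSteps {n : ℕ} (h : ℕ) (x : ℤ) (w : Fin n → Bool) : ℕ :=
  ∑ i : Fin n, if (i : ℕ) < h ∧ w i ∧ (walkLevel x w i = 0 ∨ walkLevel x w i = 1) then 1 else 0

lemma walkLevel_cons_zero {n : ℕ} (x : ℤ) (b : Bool) (w : Fin n → Bool) :
    walkLevel x (Fin.cons b w : Fin (n + 1) → Bool) 0 = x := by
  simp [walkLevel]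

lemma walkLevel_cons_succ {n : ℕ} (x : ℤ) (b : Bool) (w : Fin n → Bool) (i : Fin n) :
    walkLevel x (Fin.cons b w : Fin (n + 1) → Bool) i.succ
      = walkLevel (if b then x + 1 else x - 1) w i := by
  simp only [walkLevel, Fin.sum_univ_succ, Fin.cons_zero, Fin.cons_succ, Fin.succ_lt_succ_iff,
    Fin.succ_pos, true_and, Fin.val_succ]
  cases b <;> simp <;> ring

lemma upSteps_zero {n : ℕ} (x : ℤ) (w : Fin n → Bool) : upSteps 0 x w = 0 := by
  simp [upSteps]

lemma upSteps_cons {n : ℕ} (h : ℕ) (x : ℤ) (b : Bool) (w : Fin n → Bool) :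
    upSteps (h + 1) x (Fin.cons b w : Fin (n + 1) → Bool)
      = (if b ∧ (x = 0 ∨ x = 1) then 1 else 0) + upSteps h (if b then x + 1 else x - 1) w := by
  simp only [upSteps, Fin.sum_univ_succ, walkLevel_cons_zero, walkLevel_cons_succ, Fin.cons_zero,
    Fin.cons_succ, Fin.val_zero, Fin.val_succ, Nat.succ_pos, true_and, Nat.add_lt_add_iff_right]

lemma sum_words_succ {n : ℕ} (f : (Fin (n + 1) → Bool) → ℚ) :
    ∑ w, f w
      = ∑ w : Fin n → Bool, f (Fin.cons true w) + ∑ w : Fin n → Bool, f (Fin.cons false w) := by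
  rw [← (Fin.consEquiv (fun _ => Bool)).sum_comp, Fintype.sum_prod_type, Fintype.sum_bool]
  rfl

/-- First-step analysis: both sides satisfy the same recurrence in the number `h` of steps. -/
lemma sum_choose_upSteps (h : ℕ) : ∀ (n k : ℕ) (x : ℤ), h ≤ n →
    ∑ w : Fin n → Bool, ((upSteps h x w).choose k : ℚ)
      = 2 ^ n * PowerSeries.coeff h (binomMomentSeries k x) := by
  have hzero : ∀ (h n : ℕ) (x : ℤ), ∑ w : Fin n → Bool, ((upSteps h x w).choose 0 : ℚ)
      = 2 ^ n * PowerSeries.coeff h (binomMomentSeries 0 x) := by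
    intro h n x
    simp [binomMomentSeries, geomSeries]
  induction h with
  | zero =>
    intro n k x _
    cases k with
    | zero => exact hzero 0 n x
    | succ k =>
      have h2 := congrArg (PowerSeries.coeff 0) (binomMomentSeries_succ k x)
      rw [PowerSeries.coeff_zero_X_mul, two_mul, map_add] at h2
      have h3 : PowerSeries.coeff 0 (binomMomentSeries (k + 1) x) = 0 := by linarith
      simp [upSteps_zero, h3]
  | succ h ih =>
    intro n k x hn
    obtain ⟨n, rfl⟩ : ∃ m, n = m + 1 := ⟨n - 1, by omega⟩
    cases k with
    | zero => exact hzero (h + 1) (n + 1) x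
    | succ k =>
      have h2 := congrArg (PowerSeries.coeff (h + 1)) (binomMomentSeries_succ k x)
      rw [PowerSeries.coeff_succ_X_mul, two_mul, map_add, map_add, map_add] at h2
      have i1 := ih n (k + 1) (x + 1) (by omega)
      have i2 := ih n (k + 1) (x - 1) (by omega)
      have i3 := ih n k (x + 1) (by omega)
      rw [sum_words_succ]
      simp only [upSteps_cons, if_true, Bool.false_eq_true, false_and, if_false, zero_add, true_and]
      by_cases hx : x = 0 ∨ x = 1
      · simp only [hx, if_true] at h2 ⊢
        simp only [add_comm 1, Nat.choose_succ_succ', Nat.cast_add, Finset.sum_add_distrib, i1, i2,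
          i3]
        rw [pow_succ]
        linear_combination -(2 ^ n) * h2
      · simp only [hx, if_false, map_zero, zero_add] at h2 ⊢
        rw [i1, i2, pow_succ]
        linear_combination -(2 ^ n) * h2

/-- A power is a linear combination of binomial coefficients. -/
lemma exists_pow_eq_sum_choose (r : ℕ) : ∃ a : ℕ → ℚ,
    ∀ y : ℕ, (y : ℚ) ^ r = ∑ k ∈ Finset.range (r + 1), a k * (y.choose k : ℚ) := by
  induction r with
  | zero => exact ⟨fun _ => 1, by simp⟩
  | succ r ih =>
    obtain ⟨a, ha⟩ := ih
    -- The new coefficients come from `y * binom (y, k) = (k+1) * binom (y, k+1) + k * binom (y, k)`.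
    refine ⟨fun k => (if k = 0 then 0 else k * a (k - 1)) + if k = r + 1 then 0 else k * a k,
      fun y => ?_⟩
    have hy : ∀ k : ℕ, (y : ℚ) * y.choose k = (k + 1) * y.choose (k + 1) + k * y.choose k := by
      intro k
      have h1 : y.choose (k + 1) * (k + 1) + y.choose k * k = y.choose k * y := by
        rcases le_or_gt k y with hk | hk
        · rw [Nat.choose_succ_right_eq, ← mul_add, Nat.sub_add_cancel hk]
        · simp [Nat.choose_eq_zero_of_lt hk,
            Nat.choose_eq_zero_of_lt (hk.trans (Nat.lt_succ_self k))]
      have h2 : (y.choose (k + 1) * (k + 1) + y.choose k * k : ℚ) = y.choose k * y := by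
        exact_mod_cast h1
      linear_combination -h2
    simp only [add_mul, Finset.sum_add_distrib]
    rw [Finset.sum_range_succ' _ (r + 1), Finset.sum_range_succ _ (r + 1), pow_succ', ha,
      Finset.mul_sum]
    simp only [if_true, zero_mul, add_zero]
    rw [← Finset.sum_add_distrib]
    refine Finset.sum_congr rfl fun k hk => ?_
    rw [if_neg (by omega), if_neg (by have := Finset.mem_range.mp hk; omega)]
    push_cast
    linear_combination a k * hy k

/-! ### Riffle shuffles as words -/

/-- The word of an outcome records which positions hold cards of the first pile. -/
def pileWord {n : ℕ} (ω : Fin (n + 1) × Equiv.Perm (Fin n)) (i : Fin n) : Bool :=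
  (ω.2 i : ℕ) < ω.1

lemma card_pileWord_true {n : ℕ} (ω : Fin (n + 1) × Equiv.Perm (Fin n)) :
    (Finset.univ.filter fun i => pileWord ω i = true).card = ω.1 := by
  have h1 : (Finset.univ.filter fun i => pileWord ω i = true)
      = (Finset.univ.filter fun c : Fin n => (c : ℕ) < ω.1).map ω.2.symm.toEmbedding := by
    ext i; simp [pileWord]
  rw [h1, Finset.card_map, Fin.card_filter_val_lt]
  exact min_eq_right (Nat.le_of_lt_succ ω.1.2)

lemma card_filter_perm_lt {n : ℕ} (π : Equiv.Perm (Fin n)) (i : Fin n) :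
    (Finset.univ.filter fun j => π j < π i).card = π i := by
  have h1 : (Finset.univ.filter fun j => π j < π i)
      = (Finset.Iio (π i)).map π.symm.toEmbedding := by
    ext j; simp
  rw [h1, Finset.card_map, Fin.card_Iio]

/-- A card of the first pile is preceded exactly by the smaller cards of that pile. -/
lemma val_of_pileWord {n : ℕ} {ω : Fin (n + 1) × Equiv.Perm (Fin n)} (hω : ω ∈ riffleOutcomes n)
    {i : Fin n} (hi : pileWord ω i = true) :
    (ω.2 i : ℕ) = (Finset.univ.filter fun j => j < i ∧ pileWord ω j = true).card := by
  simp only [riffleOutcomes, Finset.mem_filter, Finset.mem_univ, true_and] at hω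
  simp only [pileWord, decide_eq_true_eq] at hi
  rw [← card_filter_perm_lt ω.2 i]
  congr 1
  ext j
  simp only [pileWord, Finset.mem_filter, Finset.mem_univ, true_and, decide_eq_true_eq]
  constructor
  · intro hj
    have hjt : (ω.2 j : ℕ) < ω.1 := lt_trans (Fin.lt_def.mp hj) hi
    refine ⟨lt_of_not_ge fun hij => ?_, hjt⟩
    rcases hij.lt_or_eq with h | h
    · exact lt_asymm hj (hω.1 i j h hi hjt)
    · subst h; exact lt_irrefl _ hj
  · rintro ⟨hji, hj⟩
    exact hω.1 j i hji hj hi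

/-- A card of the second pile has below it the whole first pile and the cards of its own pile that
precede it. -/
lemma val_of_not_pileWord {n : ℕ} {ω : Fin (n + 1) × Equiv.Perm (Fin n)}
    (hω : ω ∈ riffleOutcomes n) {i : Fin n} (hi : pileWord ω i = false) :
    (ω.2 i : ℕ) = (Finset.univ.filter fun j =>
      pileWord ω j = true ∨ j < i ∧ pileWord ω j = false).card := by
  simp only [riffleOutcomes, Finset.mem_filter, Finset.mem_univ, true_and] at hω
  simp only [pileWord, decide_eq_false_iff_not, not_lt] at hi
  rw [← card_filter_perm_lt ω.2 i]
  congr 1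
  ext j
  simp only [pileWord, Finset.mem_filter, Finset.mem_univ, true_and, decide_eq_true_eq,
    decide_eq_false_iff_not, not_lt]
  constructor
  · intro hj
    rcases lt_or_ge (ω.2 j : ℕ) ω.1 with h | h
    · exact Or.inl h
    refine Or.inr ⟨lt_of_not_ge fun hij => ?_, h⟩
    rcases hij.lt_or_eq with h' | h'
    · exact lt_asymm hj (hω.2 i j h' hi h)
    · subst h'; exact lt_irrefl _ hj
  · rintro (h | ⟨hji, hj⟩)
    · exact Fin.lt_def.mpr (lt_of_lt_of_le h hi)
    · exact hω.2 j i hji hj hi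

lemma pileWord_injOn (n : ℕ) : Set.InjOn (pileWord (n := n)) (riffleOutcomes n) := by
  intro ω hω ω' hω' h
  have h1 : ω.1 = ω'.1 := by
    apply Fin.ext
    rw [← card_pileWord_true ω, ← card_pileWord_true ω', h]
  refine Prod.ext h1 (Equiv.ext fun i => Fin.ext ?_)
  cases hi : pileWord ω i with
  | true => rw [val_of_pileWord hω hi, val_of_pileWord hω' (h ▸ hi), h]
  | false => rw [val_of_not_pileWord hω hi, val_of_not_pileWord hω' (h ▸ hi), h]

/-- The positions of the cards below the card dealt at position `i`, when the cards of the first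
pile go to the positions where the word `w` is `true`. -/
def lowerPositions {n : ℕ} (w : Fin n → Bool) (i : Fin n) : Finset (Fin n) :=
  Finset.univ.filter fun j => if w i then j < i ∧ w j = true else w j = true ∨ j < i ∧ w j = false

/-- The relation `i ∈ lowerPositions w j` is transitive and irreflexive, and it is total by
`mem_lowerPositions_or`; hence `#(lowerPositions w i)` is the rank of `i` in a linear order. -/
lemma lowerPositions_ssubset {n : ℕ} (w : Fin n → Bool) {i j : Fin n}
    (h : i ∈ lowerPositions w j) : lowerPositions w i ⊂ lowerPositions w j := by
  rw [Finset.ssubset_iff_of_subset]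
  · refine ⟨i, h, ?_⟩
    simp only [lowerPositions, Finset.mem_filter, Finset.mem_univ, true_and]
    cases hi : w i <;> simp
  · intro l
    simp only [lowerPositions, Finset.mem_filter, Finset.mem_univ, true_and] at h ⊢
    cases hi : w i <;> cases hj : w j <;> cases hl : w l <;> simp_all <;> omega

lemma card_lowerPositions_lt {n : ℕ} (w : Fin n → Bool) (i : Fin n) :
    (lowerPositions w i).card < n := by
  have : i ∉ lowerPositions w i := fun h => (lowerPositions_ssubset w h).ne rfl
  calc (lowerPositions w i).card < (Finset.univ : Finset (Fin n)).card :=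
        Finset.card_lt_card (Finset.ssubset_univ_iff.mpr fun h => this (h ▸ Finset.mem_univ i))
    _ = n := Finset.card_fin n

lemma mem_lowerPositions_or {n : ℕ} (w : Fin n → Bool) {i j : Fin n} (h : i ≠ j) :
    i ∈ lowerPositions w j ∨ j ∈ lowerPositions w i := by
  simp only [lowerPositions, Finset.mem_filter, Finset.mem_univ, true_and]
  cases hi : w i <;> cases hj : w j <;> simp <;> omega

lemma exists_pileWord_eq {n : ℕ} (w : Fin n → Bool) : ∃ ω ∈ riffleOutcomes n, pileWord ω = w := by
  let v : Fin n → Fin n := fun i => ⟨(lowerPositions w i).card, card_lowerPositions_lt w i⟩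
  have hv : ∀ i j, i ∈ lowerPositions w j → v i < v j := fun i j h =>
    Finset.card_lt_card (lowerPositions_ssubset w h)
  have hinj : Function.Injective v := by
    intro i j hij
    by_contra hne
    rcases mem_lowerPositions_or w hne with h | h
    · exact (hv _ _ h).ne hij
    · exact (hv _ _ h).ne hij.symm
  let t : Finset (Fin n) := Finset.univ.filter fun j => w j = true
  have ht : t.card < n + 1 := by
    have := Finset.card_le_univ t
    rw [Fintype.card_fin] at this
    omega
  let ω : Fin (n + 1) × Equiv.Perm (Fin n) :=
    (⟨t.card, ht⟩, Equiv.ofBijective v (Finite.injective_iff_bijective.mp hinj))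
  have hw : pileWord ω = w := by
    funext i
    change decide ((lowerPositions w i).card < t.card) = w i
    cases hi : w i with
    | true =>
      rw [decide_eq_true_eq]
      refine Finset.card_lt_card ((Finset.ssubset_iff_of_subset fun j hj => ?_).mpr ⟨i, ?_, ?_⟩)
      · simp only [lowerPositions, Finset.mem_filter, hi, if_true] at hj
        simp [t, hj.2.2]
      · simp [t, hi]
      · simp [lowerPositions, hi]
    | false =>
      rw [decide_eq_false_iff_not, not_lt]
      refine Finset.card_le_card fun j hj => ?_
      simp only [t, Finset.mem_filter] at hj
      simp [lowerPositions, hi, hj.2]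
  have hmem : ∀ i, ((ω.2 i : ℕ) < ω.1) ↔ w i = true := fun i => by
    rw [← hw, pileWord, decide_eq_true_eq]
  refine ⟨ω, ?_, hw⟩
  rw [riffleOutcomes, Finset.mem_filter]
  refine ⟨Finset.mem_univ _, fun i j hij hi hj => hv i j ?_, fun i j hij hi hj => hv i j ?_⟩
  · rw [hmem] at hi hj
    simp [lowerPositions, hi, hj, hij]
  · rw [← not_lt, hmem, Bool.not_eq_true] at hi hj
    simp [lowerPositions, hi, hj, hij]

lemma natCeil_half (n : ℕ) : ⌈(n : ℚ) / 2⌉₊ = (n + 1) / 2 := by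
  refine eq_of_forall_ge_iff fun m => ?_
  have h : (n : ℚ) ≤ m * 2 ↔ n ≤ m * 2 := by exact_mod_cast Iff.rfl
  rw [Nat.ceil_le, div_le_iff₀ two_pos, h]
  omega

lemma natDegree_le_of_mem_degreeLT {P : Polynomial ℚ} {n : ℕ}
    (h : P ∈ Polynomial.degreeLT ℚ (n + 1)) : P.natDegree ≤ n := by
  rw [Polynomial.mem_degreeLT, Polynomial.degree_lt_iff_coeff_zero] at h
  exact Polynomial.natDegree_le_iff_coeff_eq_zero.mpr fun N hN => h N hN

/-- The guess at the `0`-based position `i` of the top half is right for a card of the first pile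
exactly when the walk steps up from level `0` (`i` even) or `1` (`i` odd). -/
lemma correctTopFirst_eq_upSteps {n : ℕ} {ω : Fin (n + 1) × Equiv.Perm (Fin n)}
    (hω : ω ∈ riffleOutcomes n) :
    correctTopFirst n ω = upSteps (topHalf n) 0 (pileWord ω) := by
  rw [correctTopFirst, Finset.card_filter, upSteps]
  refine Finset.sum_congr rfl fun i _ => if_congr ?_ rfl rfl
  rw [Nat.succ_le_iff]
  refine and_congr_right fun hi => ?_
  rw [and_comm, show ((ω.2 i : ℕ) < ω.1) ↔ pileWord ω i = true by simp [pileWord]]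
  refine and_congr_right fun hw => ?_
  have hl : (∑ j, if j < i ∧ pileWord ω j then (1 : ℤ) else 0) = (ω.2 i : ℕ) := by
    rw [val_of_pileWord hω hw, Finset.card_filter]
    push_cast
    rfl
  rw [walkLevel, hl, guess, if_pos (by omega)]
  omega

lemma outcomeSum_eq_sum_words (n r : ℕ) :
    (outcomeSum n (fun ω => correctTopFirst n ω ^ r) : ℚ)
      = ∑ w : Fin n → Bool, (upSteps (topHalf n) 0 w : ℚ) ^ r := by
  rw [outcomeSum]
  push_cast
  refine Finset.sum_bij (fun ω _ => pileWord ω) (fun _ _ => Finset.mem_univ _)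
    (fun ω hω ω' hω' h => pileWord_injOn n hω hω' h) (fun w _ => ?_) (fun ω hω => ?_)
  · obtain ⟨ω, hω, h⟩ := exists_pileWord_eq w
    exact ⟨ω, hω, h⟩
  · rw [correctTopFirst_eq_upSteps hω]


theorem mainTheorem3 (r e : ℕ) :
    ∃ P Q : Polynomial ℚ,
      P.natDegree ≤ ⌈(r : ℚ) / 2⌉₊ ∧ Q.natDegree ≤ ⌊(r : ℚ) / 2⌋₊ ∧
        ∀ n L : ℕ, topHalf n ≡ e [MOD 2] → L = ⌈(topHalf n : ℚ) / 2⌉₊ →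
          (outcomeSum n (fun ω => correctTopFirst n ω ^ r) : ℚ) =
            2 ^ n * (P.eval (L : ℚ) * ((Nat.choose (2 * L) L : ℚ) / 4 ^ L) + Q.eval (L : ℚ)) := by
  obtain ⟨a, ha⟩ := exists_pow_eq_sum_choose r
  have hsum : ∀ n, (outcomeSum n (fun ω => correctTopFirst n ω ^ r) : ℚ) = 2 ^ n *
      ∑ k ∈ Finset.range (r + 1),
        a k * PowerSeries.coeff (topHalf n) (binomMomentSeries k 0) := by
    intro n
    have hn : topHalf n ≤ n := by rw [topHalf, natCeil_half]; omega
    simp only [outcomeSum_eq_sum_words, ha]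
    rw [Finset.sum_comm, Finset.mul_sum]
    refine Finset.sum_congr rfl fun k _ => ?_
    rw [← Finset.mul_sum, sum_choose_upSteps _ _ _ _ hn]
    ring
  obtain ⟨b, ⟨P, hP, Q, hQ, hPQ⟩, hb⟩ : ∃ b, IsCentralBinomForm (r + 1) b ∧
      ∀ h, h ≡ e [MOD 2] → ∑ k ∈ Finset.range (r + 1),
        a k * PowerSeries.coeff h (binomMomentSeries k 0) = b ((h + 1) / 2) := by
    rcases Nat.mod_two_eq_zero_or_one e with he | he
    · refine ⟨fun L => ∑ k ∈ Finset.range (r + 1),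
        a k * PowerSeries.coeff (2 * L) (binomMomentSeries k 0), .sum fun k hk =>
        .const_mul _ ((isCentralBinomForm_binomMomentSeries_even k).mono ?_), fun h hh => ?_⟩
      · simpa using hk
      · have hh' : 2 * ((h + 1) / 2) = h := by rw [Nat.ModEq] at hh; omega
        simp only [hh']
    · choose c hc hc' using exists_isCentralBinomForm_binomMomentSeries_odd
      refine ⟨fun L => ∑ k ∈ Finset.range (r + 1), a k * c k L, .sum fun k hk =>
        .const_mul _ ((hc k).mono ?_), fun h hh => ?_⟩
      · simpa using hk
      · obtain ⟨L, rfl⟩ : ∃ L, h = 2 * L + 1 := ⟨h / 2, by rw [Nat.ModEq] at hh; omega⟩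
        have hL : (2 * L + 1 + 1) / 2 = L + 1 := by omega
        simp only [hL, hc']
  refine ⟨P, Q, ?_, ?_, ?_⟩
  · rw [natCeil_half]
    exact natDegree_le_of_mem_degreeLT hP
  · rw [Nat.floor_div_ofNat, Nat.floor_natCast]
    exact natDegree_le_of_mem_degreeLT (Polynomial.degreeLT_mono (by omega) hQ)
  · rintro n L hn rfl
    rw [hsum, hb _ hn, hPQ, natCeil_half]
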